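/- **Setting.** Finitely many robots move in the Euclidean plane; $X(t)$ denotes the location of robot $\mathbf X$ at time $t\ge 0$, and $V>0$ is the visibility range: two robots are (mutually) visible at time $t$ if their distance at time $t$ is at most $V$. Each robot alternates between finite inactive intervals, in which it rests, and finite active intervals, all robots being initially inactive. At the start of an active interval (its activation) the robot instantaneously observes the visible robots and computes a destination; during the active interval it then moves monotonically along the straight segment towards that destination, at a rate chosen by the adversary, covering at least a fraction $\xi$ of the way (for a fixed $\xi\in(0,1]$). Every robot is active at arbitrarily late times. For an integer $k\ge 1$ the scheduling is *$k$-Async* if at most $k$ activations of one robot occur during any single active interval of another; apart from this, activation times and durations are arbitrary. **Safe regions.** For a robot $\mathbf Y$ at location $Y_0$ at one of its activations, let $V_{\mathbf Y}\le V$ be the distance to its furthest visible robot; a visible robot is a *distant neighbour* of $\mathbf Y$ if its distance from $Y_0$ exceeds $V_{\mathbf Y}/2$. The $1/k$-scaled safe region of $\mathbf Y$ with respect to a distant neighbour at location $X_0$ is the closed disk of radius $V_{\mathbf Y}/(8k)$ whose centre is the point at distance $V_{\mathbf Y}/(8k)$ from $Y_0$ in the direction of $X_0$. Robot $\mathbf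 Y$ *confines its movement to the $1/k$-scaled safe regions with respect to* $\mathbf X$ if at each of its activations (a) its destination lies in the safe region with respect to $\mathbf X$ whenever $\mathbf X$ is then a distant neighbour of $\mathbf Y$, and (b) in any case its destination is its current location or lies in the safe region with respect to at least one of its distant neighbours. **Theorem.** Let $k\ge1$, and let $\mathbf X\neq\mathbf Y$ be two robots in an execution under $k$-Async scheduling, each of which confines its movement to the $1/k$-scaled safe regions with respect to the other. (i) If $|X(0)Y(0)|\le V$, then $|X(t)Y(t)|\le V$ for all $t\ge 0$. (ii) If $|X(t)Y(t)|\le V/2$ for some time $t>0$, then $|X(t')Y(t')|\le V$ for all $t'\ge t$. -/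

import Mathlib

/-- The plane in which the robots reside, with its Euclidean distance. -/
abbrev Plane : Type := EuclideanSpace ℝ (Fin 2)

/-- The disk of radius `r` centred at the point at distance `r` from `p` in the direction of `q`
(used only for `q ≠ p`). -/
noncomputable def safeDisk (r : ℝ) (p q : Plane) : Set Plane :=
  Metric.closedBall (p + (r / dist p q) • (q - p)) r

/-- An execution, over the time axis `t ≥ 0`, of a system of robots indexed by `ι` with `ξ`-rigid
motion, all robots being inactive up to their first activation. Each robot performs a sequence of
Look-Compute-Move cycles; the `j`-th cycle of robot `i` is its `j`-th active interval, from
`start i j` (the time of the instantaneous Look) to `finish i j`. The lengths of all active and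
inactive intervals, the Compute phase and the rate of motion are arbitrary. -/
structure Execution (ι : Type*) (ξ : ℝ) where
  /-- `pos i t` is the location of robot `i` at time `t`. -/
  pos : ι → ℝ → Plane
  /-- The time at which the `j`-th active interval of robot `i` begins (its Look). -/
  start : ι → ℕ → ℝ
  /-- The time at which the `j`-th active interval of robot `i` ends. -/
  finish : ι → ℕ → ℝ
  /-- The intended destination computed by robot `i` in its `j`-th active interval. -/
  dest : ι → ℕ → Plane
  start_nonneg : ∀ i, 0 ≤ start i 0
  start_lt_finish : ∀ i j, start i j < finish i j
  finish_le_start : ∀ i j, finish i j ≤ start i (j + 1)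
  /-- Activation fairness: after every time, every robot is active at some later time. -/
  fair : ∀ i t, ∃ t', t < t' ∧ ∃ j, t' ∈ Set.Ico (start i j) (finish i j)
  /-- A robot does not move before its first activation. -/
  rest_initial : ∀ i, ∀ t ∈ Set.Icc 0 (start i 0), pos i t = pos i 0
  /-- A robot does not move while it is inactive. -/
  rest : ∀ i j, ∀ t ∈ Set.Icc (finish i j) (start i (j + 1)), pos i t = pos i (finish i j)
  /-- In an active interval a robot moves along the straight segment towards its destination, at
  any (possibly zero) varying rate, and covers at least the fraction `ξ` of the way; `p t` is the
  fraction covered up to time `t`, which is zero during the Compute phase. -/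
  move : ∀ i j, ∃ p : ℝ → ℝ,
    ContinuousOn p (Set.Icc (start i j) (finish i j)) ∧
    MonotoneOn p (Set.Icc (start i j) (finish i j)) ∧
    p (start i j) = 0 ∧ ξ ≤ p (finish i j) ∧ p (finish i j) ≤ 1 ∧
    ∀ t ∈ Set.Icc (start i j) (finish i j),
      pos i t = pos i (start i j) + p t • (dest i j - pos i (start i j))

namespace Execution

variable {ι : Type*} {ξ : ℝ}

/-- `k`-asynchronous scheduling: at most `k` activations of one robot occur within a single active
interval of another. -/
def IsKAsync (E : Execution ι ξ) (k : ℕ) : Prop :=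
  ∀ x y : ι, x ≠ y → ∀ j : ℕ,
    {i : ℕ | E.start y i ∈ Set.Ico (E.start x j) (E.finish x j)}.encard ≤ k

/-- Robots `x` and `y` are mutually visible at time `t`, for the visibility range `V`. -/
def Visible (E : Execution ι ξ) (V : ℝ) (x y : ι) (t : ℝ) : Prop :=
  dist (E.pos x t) (E.pos y t) ≤ V

/-- Robots `x` and `y` are strongly visible from each other at time `t`. -/
def StronglyVisible (E : Execution ι ξ) (V : ℝ) (x y : ι) (t : ℝ) : Prop :=
  dist (E.pos x t) (E.pos y t) ≤ V / 2

/-- The distance, at time `t`, from robot `x` to the furthest of the other robots visible to it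
(`0` if there is none). -/
noncomputable def furthest (E : Execution ι ξ) (V : ℝ) (x : ι) (t : ℝ) : ℝ :=
  sSup ((fun z => dist (E.pos x t) (E.pos z t)) '' {z | z ≠ x ∧ E.Visible V x z t})

/-- Robot `z` is a distant neighbour of robot `x` at time `t`: it is visible to `x`, at a distance
greater than half the distance from `x` to its furthest visible robot. -/
def DistantNeighbour (E : Execution ι ξ) (V : ℝ) (x z : ι) (t : ℝ) : Prop :=
  z ≠ x ∧ E.Visible V x z t ∧ E.furthest V x t / 2 < dist (E.pos x t) (E.pos z t)

/-- The `1/k`-scaled safe region for motion of robot `x` with respect to robot `z`, both at their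
locations at time `t`. -/
noncomputable def safeRegion (E : Execution ι ξ) (k : ℕ) (V : ℝ) (x z : ι) (t : ℝ) : Set Plane :=
  safeDisk (E.furthest V x t / (8 * k)) (E.pos x t) (E.pos z t)

/-- Robot `x` confines its movement to the `1/k`-scaled safe regions with respect to robot `y`.
In each of its activations, the chosen destination lies in the safe region with respect to `y`
whenever `y` is then a distant neighbour of `x`. When `y` is not a distant neighbour there is no
safe region with respect to `y`, and all that is asked is what every robot is subject to in any
case: it plans no motion, or its destination lies in the safe region of at least one of its
distant neighbours. -/
def ConfinesTo (E : Execution ι ξ) (k : ℕ) (V : ℝ) (x y : ι) : Prop :=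
  ∀ j : ℕ,
    (E.DistantNeighbour V x y (E.start x j) →
      E.dest x j ∈ E.safeRegion k V x y (E.start x j)) ∧
    (E.dest x j = E.pos x (E.start x j) ∨
      ∃ z, E.DistantNeighbour V x z (E.start x j) ∧
        E.dest x j ∈ E.safeRegion k V x z (E.start x j))

end Execution

-- Fix a time `T`, freeze all motion at `T`, and follow the endpoints `restPos` of the truncated
-- moves as looks are added one at a time. A confined move of length `m` makes an angle with the
-- line of sight that lowers the squared distance to the observed point by at least `(4k-1)m²`. If
-- the observed robot still has a distance `d` to go, the squared distance to its endpoint falls by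
-- at least `(4k-2)m² - d²`. Of this gain, `k m²` is kept in `reserve`: each look of the other robot
-- during the move withdraws at most `m²`, and `k`-Async scheduling allows at most `k` such looks.
-- So squared distance plus reserves stays at most `V²`. A robot that sees the other within `V/2`
-- may move arbitrarily, but only by `V/4`. Then the distance plus both remaining paths is at most
-- `V`, and `HalfSecure` bridges the period until that unconfined move is over. At `T` the endpoints
-- are the actual positions. The visibility needed at earlier looks comes from strong induction on
-- the number of looks. The step is `Secure.succ_left`; `secure_of_secure` iterates it.

section Geometry

-- Geometry of a single confined move.

open scoped RealInnerProductSpace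

/-- With `v = d - p`, `L = dist p q` and `r = F / (8k)`, membership in a disk through `p` says
`L‖v‖² + 2r⟪v, p - q⟫ ≤ 0`. Multiplying by `4k` and using `L > F / 2` gives the bound times `F`; if
`F = 0`, the disk is a point and `v = 0`. -/
theorem inner_le_of_mem_safeDisk {F k : ℝ} (hF : 0 ≤ F) (hk : 0 < k) {p q d : Plane}
    (hpq : F / 2 < dist p q) (hd : d ∈ safeDisk (F / (8 * k)) p q) :
    ⟪d - p, p - q⟫ ≤ -(2 * k) * ‖d - p‖ ^ 2 := by
  have hL : 0 < dist p q := by linarith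
  rw [safeDisk, Metric.mem_closedBall, dist_eq_norm] at hd
  set L := dist p q with hLdef
  set r := F / (8 * k) with hr
  have hr0 : 0 ≤ r := by positivity
  set v := d - p with hv
  have h1 : d - (p + (r / L) • (q - p)) = v + (r / L) • (p - q) := by
    rw [hv, ← neg_sub p q, smul_neg]; abel
  rw [h1] at hd
  have h2 : ‖v + (r / L) • (p - q)‖ ^ 2 ≤ r ^ 2 := by gcongr
  rw [norm_add_sq_real, norm_smul, inner_smul_right, mul_pow, ← dist_eq_norm p q, ← hLdef,
    Real.norm_eq_abs, sq_abs, ← mul_pow, div_mul_cancel₀ _ hL.ne'] at h2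
  set I := ⟪v, p - q⟫ with hI
  have h3 : L * ‖v‖ ^ 2 + 2 * (r * I) ≤ 0 := by
    have : L * (‖v‖ ^ 2 + 2 * (r / L * I)) ≤ L * 0 := by gcongr; linarith
    have h4 : L * (‖v‖ ^ 2 + 2 * (r / L * I)) = L * ‖v‖ ^ 2 + 2 * (r * I) := by field_simp
    linarith
  rcases hF.eq_or_lt with h0 | hFpos
  · have hr' : r = 0 := by rw [hr, ← h0, zero_div]
    rw [hr'] at h3
    have h5 : ‖v‖ ^ 2 = 0 := by
      have : 0 ≤ ‖v‖ ^ 2 := by positivity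
      nlinarith
    have h6 : v = 0 := by simpa using h5
    simp [hI, h6]
  · have h5 : r * (8 * k) = F := by rw [hr]; field_simp
    have h6 : 0 ≤ (L - F / 2) * ‖v‖ ^ 2 := mul_nonneg (by linarith) (by positivity)
    have h7 : F * (I + 2 * k * ‖v‖ ^ 2) ≤ 0 := by
      have e : F * I = 4 * k * (2 * (r * I)) := by rw [← h5]; ring
      have : 4 * k * (L * ‖v‖ ^ 2 + 2 * (r * I)) ≤ 0 :=
        mul_nonpos_of_nonneg_of_nonpos (by positivity) h3
      have h8 : 0 ≤ 4 * k * ((L - F / 2) * ‖v‖ ^ 2) := by positivity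
      nlinarith
    have := nonpos_of_mul_nonpos_right h7 hFpos
    linarith

theorem dist_le_of_mem_safeDisk {r : ℝ} (hr : 0 ≤ r) {p q d : Plane}
    (hd : d ∈ safeDisk r p q) : dist d p ≤ 2 * r := by
  rw [safeDisk, Metric.mem_closedBall] at hd
  have h : dist (p + (r / dist p q) • (q - p)) p ≤ r := by
    rw [dist_eq_norm, add_sub_cancel_left, norm_smul, ← dist_eq_norm q p, dist_comm q p,
      Real.norm_eq_abs, abs_of_nonneg (by positivity)]
    rcases eq_or_ne (dist p q) 0 with h | h
    · simpa [h] using hr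
    · rw [div_mul_cancel₀ _ h]
  linarith [dist_triangle d (p + (r / dist p q) • (q - p)) p]

/-- Moving from `a` to `a'` while observing `c` does not increase the distance to `c`, and leaves
an amount of energy that is quadratic in the length of the move. -/
theorem dist_sq_le_of_inner_le {k : ℝ} {a a' c : Plane}
    (h : ⟪a' - a, a - c⟫ ≤ -(2 * k) * ‖a' - a‖ ^ 2) :
    dist a' c ^ 2 ≤ dist a c ^ 2 - (4 * k - 1) * ‖a' - a‖ ^ 2 := by
  have e : a' - c = (a' - a) + (a - c) := by abel
  rw [dist_eq_norm, dist_eq_norm, e, norm_add_sq_real]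
  linarith

/-- The energy after a move from `a` to `a'` that observes a moving robot at `c`, whose own move
will end at `b`. -/
theorem dist_sq_le_of_inner_le_of_pending {k : ℝ} {a a' b c : Plane}
    (h : ⟪a' - a, a - c⟫ ≤ -(2 * k) * ‖a' - a‖ ^ 2) :
    dist a' b ^ 2 ≤ dist a b ^ 2 - (4 * k - 2) * ‖a' - a‖ ^ 2 + dist c b ^ 2 := by
  have e : a' - b = (a' - a) + (a - b) := by abel
  have e' : a - b = (a - c) + (c - b) := by abel
  rw [dist_eq_norm, dist_eq_norm, dist_eq_norm, e, norm_add_sq_real]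
  have h1 : ⟪a' - a, a - b⟫ = ⟪a' - a, a - c⟫ + ⟪a' - a, c - b⟫ := by
    rw [← inner_add_right, ← e']
  have h2 := real_inner_le_norm (a' - a) (c - b)
  -- The cross term `2‖a' - a‖‖c - b‖` is split by AM-GM, which lowers the coefficient from `4k - 1`
  -- to `4k - 2`.
  nlinarith [sq_nonneg (‖a' - a‖ - ‖c - b‖)]

end Geometry

-- Looks, truncated moves and their endpoints.

namespace Execution

variable {ι : Type*} {ξ : ℝ}

theorem Visible.symm {E : Execution ι ξ} {V : ℝ} {x y : ι} {t : ℝ}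
    (h : E.Visible V x y t) : E.Visible V y x t := by
  rwa [Visible, dist_comm]

theorem furthest_nonneg (E : Execution ι ξ) (V : ℝ) (x : ι) (t : ℝ) : 0 ≤ E.furthest V x t := by
  apply Real.sSup_nonneg
  rintro _ ⟨z, -, rfl⟩
  exact dist_nonneg

theorem furthest_le (E : Execution ι ξ) {V : ℝ} (hV : 0 ≤ V) (x : ι) (t : ℝ) :
    E.furthest V x t ≤ V := by
  apply Real.sSup_le _ hV
  rintro _ ⟨z, ⟨-, hz⟩, rfl⟩
  exact hz

/-- The time of the last of the first `i` looks of robot `z`, and `0` if `i = 0`. -/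
def prevLook (E : Execution ι ξ) (z : ι) : ℕ → ℝ
  | 0 => 0
  | i + 1 => E.start z i

/-- The place where robot `z` ends the last of its first `i` moves, if all motion is frozen at
time `T`. -/
noncomputable def restPos (E : Execution ι ξ) (T : ℝ) (z : ι) : ℕ → Plane
  | 0 => E.pos z 0
  | i + 1 => E.pos z (min (E.finish z i) T)

/-- The last of the first `i` moves of robot `z`, if all motion is frozen at time `T`. -/
noncomputable def lastMove (E : Execution ι ξ) (T : ℝ) (z : ι) (i : ℕ) : Plane :=
  E.restPos T z i - E.restPos T z (i - 1)

theorem start_mono (E : Execution ι ξ) (z : ι) : Monotone (E.start z) :=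
  monotone_nat_of_le_succ fun i => ((E.start_lt_finish z i).trans_le (E.finish_le_start z i)).le

theorem prevLook_le_start (E : Execution ι ξ) (z : ι) (i : ℕ) :
    E.prevLook z i ≤ E.start z i := by
  cases i with
  | zero => exact E.start_nonneg z
  | succ i => exact E.start_mono z i.le_succ

theorem exists_le_start (E : Execution ι ξ) (z : ι) (t : ℝ) : ∃ i, t ≤ E.start z i := by
  obtain ⟨t', ht, j, hj⟩ := E.fair z t
  exact ⟨j + 1, (ht.trans (hj.2.trans_le (E.finish_le_start z j))).le⟩

open Classical in
/-- The number of looks of robot `z` before time `t`. -/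
noncomputable def lookCount (E : Execution ι ξ) (z : ι) (t : ℝ) : ℕ :=
  Nat.find (E.exists_le_start z t)

theorem le_start_lookCount (E : Execution ι ξ) (z : ι) (t : ℝ) :
    t ≤ E.start z (E.lookCount z t) := by
  classical exact Nat.find_spec (E.exists_le_start z t)

theorem lookCount_le_iff (E : Execution ι ξ) (z : ι) (t : ℝ) (i : ℕ) :
    E.lookCount z t ≤ i ↔ t ≤ E.start z i := by
  refine ⟨fun h => (E.le_start_lookCount z t).trans (E.start_mono z h), fun h => ?_⟩
  classical exact Nat.find_min' (E.exists_le_start z t) h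

theorem lookCount_mono (E : Execution ι ξ) (z : ι) : Monotone (E.lookCount z) := fun _ t h =>
  (E.lookCount_le_iff z _ _).2 (h.trans (E.le_start_lookCount z t))

theorem prevLook_lookCount_lt (E : Execution ι ξ) (z : ι) (t : ℝ) (h : 0 < E.lookCount z t) :
    E.prevLook z (E.lookCount z t) < t := by
  obtain ⟨i, hi⟩ := Nat.exists_eq_succ_of_ne_zero h.ne'
  rw [hi]
  have : ¬ E.lookCount z t ≤ i := by omega
  rwa [lookCount_le_iff, not_le] at this

theorem prevLook_lookCount_le (E : Execution ι ξ) (z : ι) {t : ℝ} (ht : 0 ≤ t) :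
    E.prevLook z (E.lookCount z t) ≤ t := by
  rcases Nat.eq_zero_or_pos (E.lookCount z t) with h | h
  · rwa [h]
  · exact (E.prevLook_lookCount_lt z t h).le

/-- From one look to the next, a robot moves monotonically along a segment. -/
theorem exists_progress (E : Execution ι ξ) (z : ι) (i : ℕ) :
    ∃ p : ℝ → ℝ, MonotoneOn p (Set.Icc (E.start z i) (E.start z (i + 1))) ∧
      p (E.start z i) = 0 ∧
      (∀ t ∈ Set.Icc (E.start z i) (E.start z (i + 1)), p t ≤ 1 ∧
        E.pos z t = E.pos z (E.start z i) + p t • (E.dest z i - E.pos z (E.start z i))) := by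
  obtain ⟨p, -, hmono, h0, -, h1, hp⟩ := E.move z i
  have hsf := (E.start_lt_finish z i).le
  have hfs := E.finish_le_start z i
  have hmem : ∀ t ∈ Set.Icc (E.start z i) (E.start z (i + 1)),
      min t (E.finish z i) ∈ Set.Icc (E.start z i) (E.finish z i) := fun t ht =>
    ⟨le_min ht.1 hsf, min_le_right _ _⟩
  -- Progress is held constant after the end of the move, so that the following rest is covered too.
  refine ⟨fun t => p (min t (E.finish z i)), fun a ha b hb hab => ?_, ?_, fun t ht => ⟨?_, ?_⟩⟩
  · exact hmono (hmem a ha) (hmem b hb) (min_le_min_right _ hab)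
  · simp [min_eq_left hsf, h0]
  · exact (hmono (hmem t ht) ⟨hsf, le_rfl⟩ (min_le_right _ _)).trans h1
  · dsimp only
    rw [← hp _ (hmem t ht)]
    rcases le_total t (E.finish z i) with h | h
    · rw [min_eq_left h]
    · rw [min_eq_right h]
      exact E.rest z i t ⟨h, ht.2⟩

/-- The endpoint is reached in three situations: at the freezing time, at the next look, and after
the end of the move. -/
theorem pos_eq_restPos (E : Execution ι ξ) {T : ℝ} {z : ι} {i : ℕ} {u : ℝ}
    (h₁ : E.prevLook z i ≤ u) (h₂ : u ≤ E.start z i) (h₃ : u ≤ T)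
    (h : u = T ∨ u = E.start z i ∨ ∃ j, i = j + 1 ∧ E.finish z j ≤ u) :
    E.pos z u = E.restPos T z i := by
  cases i with
  | zero => exact E.rest_initial z u ⟨h₁, h₂⟩
  | succ i =>
    rw [restPos]
    rcases le_total (E.finish z i) u with hf | hf
    · rw [min_eq_left (hf.trans h₃)]
      exact E.rest z i u ⟨hf, h₂⟩
    · have hfs := E.finish_le_start z i
      rcases h with h | h | ⟨j, hj, h⟩
      · rw [min_eq_right (h ▸ hf), h]
      · have : u = E.finish z i := by linarith
        rw [min_eq_left (this ▸ h₃), this]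
      · have : u = E.finish z i := by
          obtain rfl : i = j := by omega
          linarith
        rw [min_eq_left (this ▸ h₃), this]

/-- The path between consecutive looks is straight and monotone, so distance travelled and distance
left add up exactly. -/
theorem dist_add_dist_restPos (E : Execution ι ξ) {T : ℝ} {z : ι} {i : ℕ} {u v : ℝ}
    (hu : E.prevLook z i ≤ u) (huv : u ≤ v) (hv : v ≤ E.start z i) (hT : v ≤ T) :
    dist (E.pos z u) (E.pos z v) + dist (E.pos z v) (E.restPos T z i)
      = dist (E.pos z u) (E.restPos T z i) := by
  cases i with
  | zero =>
    simp [E.rest_initial z u ⟨hu, huv.trans hv⟩, E.rest_initial z v ⟨hu.trans huv, hv⟩, restPos]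
  | succ i =>
    rcases le_or_gt (E.finish z i) v with hf | hf
    · rw [E.pos_eq_restPos (hu.trans huv) hv hT (Or.inr (Or.inr ⟨i, rfl, hf⟩)), dist_self, add_zero]
    · obtain ⟨p, hmono, -, hp⟩ := E.exists_progress z i
      have hvw : v ≤ min (E.finish z i) T := le_min hf.le hT
      have hw : min (E.finish z i) T ≤ E.start z (i + 1) :=
        (min_le_left _ _).trans (E.finish_le_start z i)
      have hu' : u ∈ Set.Icc (E.start z i) (E.start z (i + 1)) := ⟨hu, huv.trans hv⟩
      have hv' : v ∈ Set.Icc (E.start z i) (E.start z (i + 1)) := ⟨hu.trans huv, hv⟩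
      have hw' : min (E.finish z i) T ∈ Set.Icc (E.start z i) (E.start z (i + 1)) :=
        ⟨hv'.1.trans hvw, hw⟩
      rw [restPos, (hp _ hu').2, (hp _ hv').2, (hp _ hw').2]
      simp only [dist_add_left]
      simp only [dist_eq_norm, ← sub_smul, norm_smul, Real.norm_eq_abs]
      have h₁ := hmono hu' hv' huv
      have h₂ := hmono hv' hw' hvw
      rw [abs_of_nonpos (by linarith), abs_of_nonpos (by linarith), abs_of_nonpos (by linarith)]
      ring

theorem dist_restPos_le_norm_lastMove (E : Execution ι ξ) {T : ℝ} {z : ι} {i : ℕ} {u : ℝ}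
    (h₁ : E.prevLook z i ≤ u) (h₂ : u ≤ E.start z i) (h₃ : u ≤ T) :
    dist (E.pos z u) (E.restPos T z i) ≤ ‖E.lastMove T z i‖ := by
  cases i with
  | zero => simp [E.rest_initial z u ⟨h₁, h₂⟩, restPos]
  | succ i =>
    have h := E.dist_add_dist_restPos (le_refl (E.prevLook z (i + 1))) h₁ h₂ h₃
    have hs : E.pos z (E.start z i) = E.restPos T z i :=
      E.pos_eq_restPos (E.prevLook_le_start z i) le_rfl (le_trans h₁ h₃) (Or.inr (Or.inl rfl))
    rw [prevLook, hs] at h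
    rw [lastMove, Nat.add_sub_cancel, ← dist_eq_norm, dist_comm (E.restPos T z (i + 1))]
    have : 0 ≤ dist (E.restPos T z i) (E.pos z u) := dist_nonneg
    linarith

/-- A truncated move is a fraction of the planned move. -/
theorem exists_lastMove_eq (E : Execution ι ξ) {T : ℝ} {z : ι} {i : ℕ} (hT : E.start z i ≤ T) :
    ∃ c ∈ Set.Icc (0 : ℝ) 1,
      E.lastMove T z (i + 1) = c • (E.dest z i - E.pos z (E.start z i)) := by
  obtain ⟨p, hmono, h0, hp⟩ := E.exists_progress z i
  have hs : E.pos z (E.start z i) = E.restPos T z i :=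
    E.pos_eq_restPos (E.prevLook_le_start z i) le_rfl hT (Or.inr (Or.inl rfl))
  have hw : min (E.finish z i) T ∈ Set.Icc (E.start z i) (E.start z (i + 1)) :=
    ⟨le_min (E.start_lt_finish z i).le hT, (min_le_left _ _).trans (E.finish_le_start z i)⟩
  refine ⟨p (min (E.finish z i) T), ⟨?_, (hp _ hw).1⟩, ?_⟩
  · rw [← h0]
    exact hmono ⟨le_rfl, E.start_mono z i.le_succ⟩ hw hw.1
  · rw [lastMove, Nat.add_sub_cancel, ← hs, restPos, (hp _ hw).2, add_sub_cancel_left]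

-- Consequences of confinement for one move.

section Confined

variable {E : Execution ι ξ} {V : ℝ} {k : ℕ} {x y : ι}

theorem ConfinesTo.norm_lastMove_le (hx : E.ConfinesTo k V x y) (hV : 0 ≤ V) (hk : 1 ≤ k) {T : ℝ}
    {i : ℕ} (h : E.prevLook x i ≤ T) : ‖E.lastMove T x i‖ ≤ V / 4 := by
  cases i with
  | zero => simpa [lastMove] using div_nonneg hV zero_le_four
  | succ i =>
    obtain ⟨c, hc, e⟩ := E.exists_lastMove_eq (T := T) (z := x) (i := i) h
    have hd : ‖E.dest x i - E.pos x (E.start x i)‖ ≤ V / 4 := by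
      rcases (hx i).2 with h | ⟨z, -, hz⟩
      · rw [h, sub_self, norm_zero]; positivity
      · have hF := E.furthest_nonneg V x (E.start x i)
        have hF' := E.furthest_le hV x (E.start x i)
        have hk' : (1 : ℝ) ≤ k := by exact_mod_cast hk
        rw [← dist_eq_norm]
        refine (dist_le_of_mem_safeDisk (by positivity) hz).trans ?_
        rw [← mul_div_assoc, div_le_div_iff₀ (by positivity) (by norm_num)]
        nlinarith
    rw [e, norm_smul, Real.norm_eq_abs, abs_of_nonneg hc.1]
    exact (mul_le_of_le_one_left (norm_nonneg _) hc.2).trans hd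

/-- A look either finds the two robots strongly visible from each other, or leads to a move that is
confined to the safe region. -/
theorem ConfinesTo.stronglyVisible_or_inner_le (hx : E.ConfinesTo k V x y) (hV : 0 ≤ V)
    (hk : 1 ≤ k) (hxy : x ≠ y) {T : ℝ} {i : ℕ} (hT : E.start x i ≤ T)
    (hvis : E.Visible V x y (E.start x i)) :
    E.StronglyVisible V x y (E.start x i) ∨
      inner ℝ (E.lastMove T x (i + 1)) (E.pos x (E.start x i) - E.pos y (E.start x i)) ≤
        -(2 * k) * ‖E.lastMove T x (i + 1)‖ ^ 2 := by
  have hF := E.furthest_nonneg V x (E.start x i)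
  have hF' := E.furthest_le hV x (E.start x i)
  rcases le_or_gt (dist (E.pos x (E.start x i)) (E.pos y (E.start x i)))
    (E.furthest V x (E.start x i) / 2) with h | h
  · left
    rw [StronglyVisible]
    linarith
  · right
    obtain ⟨c, hc, e⟩ := E.exists_lastMove_eq hT
    have hk' : (0 : ℝ) < k := by exact_mod_cast hk
    have hin := inner_le_of_mem_safeDisk hF hk' h ((hx i).1 ⟨hxy.symm, hvis, h⟩)
    rw [e, inner_smul_left, norm_smul, mul_pow, Real.norm_eq_abs, sq_abs]
    simp only [conj_trivial]
    set N := ‖E.dest x i - E.pos x (E.start x i)‖ ^ 2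
    have hN : 0 ≤ N := by positivity
    have h₁ := mul_le_mul_of_nonneg_left hin hc.1
    -- A truncated move keeps the bound: the inner product scales by `c` and the squared length by
    -- `c² ≤ c`.
    have h₂ : 0 ≤ (c * (1 - c)) * (k * N) :=
      mul_nonneg (mul_nonneg hc.1 (by linarith [hc.2])) (by positivity)
    nlinarith

end Confined

-- The reserve of a move.

open Classical in
/-- The number of looks that robot `w` may still make during the last of the first `i` moves of
robot `z`, after its first `j` looks. -/
noncomputable def reserve (E : Execution ι ξ) (k : ℕ) (z w : ι) : ℕ → ℕ → ℝ
  | 0, _ => 0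
  | i + 1, j => k - ((Finset.range j).filter fun m =>
      E.start w m ∈ Set.Ico (E.start z i) (E.finish z i)).card

theorem reserve_le (E : Execution ι ξ) (k : ℕ) (z w : ι) (i j : ℕ) :
    E.reserve k z w i j ≤ k := by
  cases i with
  | zero => simp [reserve]
  | succ i => simp [reserve]

/-- This is where the scheduling bound enters: the counted looks all fall in one active interval. -/
theorem IsKAsync.reserve_nonneg {E : Execution ι ξ} {k : ℕ} (hE : E.IsKAsync k) {z w : ι}
    (hzw : z ≠ w) (i j : ℕ) : 0 ≤ E.reserve k z w i j := by
  classical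
  cases i with
  | zero => simp [reserve]
  | succ i =>
    rw [reserve, sub_nonneg, Nat.cast_le]
    have h := (Set.encard_le_encard (s := (((Finset.range j).filter fun m =>
      E.start w m ∈ Set.Ico (E.start z i) (E.finish z i) : Finset ℕ) : Set ℕ))
      (fun m hm => (Finset.mem_filter.1 (Finset.mem_coe.1 hm)).2)).trans (hE z w hzw i)
    rw [Set.encard_coe_eq_coe_finsetCard] at h
    convert Nat.cast_le.1 h

theorem reserve_succ_le (E : Execution ι ξ) (k : ℕ) (z w : ι) (i j : ℕ) :
    E.reserve k z w i (j + 1) ≤ E.reserve k z w i j := by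
  classical
  cases i with
  | zero => simp [reserve]
  | succ i =>
    rw [reserve, reserve]
    gcongr
    exact j.le_succ

theorem reserve_succ_eq (E : Execution ι ξ) (k : ℕ) (z w : ι) (i j : ℕ)
    (h : E.start w j ∈ Set.Ico (E.start z i) (E.finish z i)) :
    E.reserve k z w (i + 1) (j + 1) = E.reserve k z w (i + 1) j - 1 := by
  classical
  rw [reserve, reserve, Finset.range_add_one, Finset.filter_insert, if_pos h,
    Finset.card_insert_of_notMem (by simp)]
  push_cast
  ring

/-- What remains of a move at a look of the other robot is paid for by the reserve. -/
theorem dist_sq_add_reserve_le (E : Execution ι ξ) (k : ℕ) {T : ℝ} {z w : ι} {i j : ℕ}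
    (h₁ : E.prevLook z i ≤ E.start w j) (h₂ : E.start w j ≤ E.start z i)
    (h₃ : E.start w j ≤ T) :
    dist (E.pos z (E.start w j)) (E.restPos T z i) ^ 2
        + E.reserve k z w i (j + 1) * ‖E.lastMove T z i‖ ^ 2 ≤
      E.reserve k z w i j * ‖E.lastMove T z i‖ ^ 2 := by
  cases i with
  | zero => simp [E.rest_initial z _ ⟨h₁, h₂⟩, restPos, reserve]
  | succ i =>
    rcases le_or_gt (E.finish z i) (E.start w j) with hf | hf
    · rw [E.pos_eq_restPos h₁ h₂ h₃ (Or.inr (Or.inr ⟨i, rfl, hf⟩)), dist_self]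
      have := mul_le_mul_of_nonneg_right (E.reserve_succ_le k z w (i + 1) j)
        (sq_nonneg ‖E.lastMove T z (i + 1)‖)
      linarith
    · rw [E.reserve_succ_eq k z w i j ⟨h₁, hf⟩]
      have := E.dist_restPos_le_norm_lastMove h₁ h₂ h₃
      have h : dist (E.pos z (E.start w j)) (E.restPos T z (i + 1)) ^ 2
        ≤ ‖E.lastMove T z (i + 1)‖ ^ 2 := by gcongr
      linarith

-- The invariant and its preservation at a look.

/-- At time `u ≤ T`, robots `x` and `y` have made `i` and `j` looks; a look at time `u` itself may
or may not be counted. -/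
def AtStage (E : Execution ι ξ) (T : ℝ) (x y : ι) (i j : ℕ) (u : ℝ) : Prop :=
  (E.prevLook x i ≤ u ∧ u ≤ E.start x i) ∧ (E.prevLook y j ≤ u ∧ u ≤ E.start y j) ∧ u ≤ T

theorem AtStage.symm {E : Execution ι ξ} {T : ℝ} {x y : ι} {i j : ℕ} {u : ℝ}
    (h : E.AtStage T x y i j u) : E.AtStage T y x j i u := ⟨h.2.1, h.1, h.2.2⟩

/-- Robot `x` is still executing a move of which nothing but its length is known, while the last
move of robot `y` is confined. -/
def HalfSecure (E : Execution ι ξ) (k : ℕ) (V T : ℝ) (x y : ι) (i j : ℕ) : Prop :=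
  (∀ u, E.AtStage T x y i j u →
    dist (E.pos x u) (E.restPos T y j) + dist (E.pos x u) (E.restPos T x i) ≤ V) ∧
  dist (E.restPos T x i) (E.restPos T y j) ^ 2
    + E.reserve k y x j i * ‖E.lastMove T y j‖ ^ 2 ≤ V ^ 2

/-- The invariant, after `i` looks of robot `x` and `j` looks of robot `y`. -/
def Secure (E : Execution ι ξ) (k : ℕ) (V T : ℝ) (x y : ι) (i j : ℕ) : Prop :=
  (∃ u, E.AtStage T x y i j u ∧ dist (E.pos x u) (E.pos y u) +
    dist (E.pos x u) (E.restPos T x i) + dist (E.pos y u) (E.restPos T y j) ≤ V) ∨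
  E.HalfSecure k V T x y i j ∨ E.HalfSecure k V T y x j i ∨
  dist (E.restPos T x i) (E.restPos T y j) ^ 2 + E.reserve k x y i j * ‖E.lastMove T x i‖ ^ 2
    + E.reserve k y x j i * ‖E.lastMove T y j‖ ^ 2 ≤ V ^ 2

section Invariant

variable {E : Execution ι ξ} {k : ℕ} {V T : ℝ} {x y : ι} {i j : ℕ}

theorem Secure.symm (h : E.Secure k V T x y i j) : E.Secure k V T y x j i := by
  rcases h with ⟨u, hu, h⟩ | h | h | h
  · refine Or.inl ⟨u, hu.symm, ?_⟩
    rw [dist_comm (E.pos y u) (E.pos x u)]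
    linarith
  · exact Or.inr (Or.inr (Or.inl h))
  · exact Or.inr (Or.inl h)
  · refine Or.inr (Or.inr (Or.inr ?_))
    rw [dist_comm]
    linarith

theorem HalfSecure.dist_restPos_le (hE : E.IsKAsync k) (hxy : x ≠ y) (hV : 0 ≤ V)
    (h : E.HalfSecure k V T x y i j) : dist (E.restPos T x i) (E.restPos T y j) ≤ V := by
  refine abs_le_of_sq_le_sq' ?_ hV |>.2
  have := mul_nonneg (hE.reserve_nonneg hxy.symm j i) (sq_nonneg ‖E.lastMove T y j‖)
  linarith [h.2]

theorem Secure.dist_restPos_le (hE : E.IsKAsync k) (hxy : x ≠ y) (hV : 0 ≤ V)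
    (h : E.Secure k V T x y i j) : dist (E.restPos T x i) (E.restPos T y j) ≤ V := by
  rcases h with ⟨u, -, h⟩ | h | h | h
  · have h₁ := dist_triangle4 (E.restPos T x i) (E.pos x u) (E.pos y u) (E.restPos T y j)
    rw [dist_comm (E.restPos T x i) (E.pos x u)] at h₁
    linarith
  · exact h.dist_restPos_le hE hxy hV
  · rw [dist_comm]
    exact h.dist_restPos_le hE hxy.symm hV
  · refine abs_le_of_sq_le_sq' ?_ hV |>.2
    have h₁ := mul_nonneg (hE.reserve_nonneg hxy i j) (sq_nonneg ‖E.lastMove T x i‖)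
    have h₂ := mul_nonneg (hE.reserve_nonneg hxy.symm j i) (sq_nonneg ‖E.lastMove T y j‖)
    linarith

/-- The budget is `V/2 + V/4 + V/4 = V`, whatever the directions of the two moves. -/
theorem AtStage.secure_of_stronglyVisible {u : ℝ} (hu : E.AtStage T x y i j u)
    (hmx : ‖E.lastMove T x i‖ ≤ V / 4) (hmy : ‖E.lastMove T y j‖ ≤ V / 4)
    (h : E.StronglyVisible V x y u) : E.Secure k V T x y i j := by
  refine Or.inl ⟨u, hu, ?_⟩
  have h₁ := E.dist_restPos_le_norm_lastMove hu.1.1 hu.1.2 hu.2.2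
  have h₂ := E.dist_restPos_le_norm_lastMove hu.2.1.1 hu.2.1.2 hu.2.2
  rw [StronglyVisible] at h
  linarith

/-- A confined move of robot `x`, observing robot `y` in the course of an arbitrary move. -/
theorem halfSecure_of_inner_le (hk : 1 ≤ k)
    (hs : E.AtStage T x y i j (E.start x i))
    (hin : inner ℝ (E.lastMove T x (i + 1)) (E.pos x (E.start x i) - E.pos y (E.start x i)) ≤
      -(2 * k) * ‖E.lastMove T x (i + 1)‖ ^ 2)
    (h : dist (E.pos y (E.start x i)) (E.restPos T x i)
      + dist (E.pos y (E.start x i)) (E.restPos T y j) ≤ V) :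
    E.HalfSecure k V T y x j (i + 1) := by
  have hk' : (1 : ℝ) ≤ k := by exact_mod_cast hk
  have hp : E.pos x (E.start x i) = E.restPos T x i :=
    E.pos_eq_restPos hs.1.1 hs.1.2 hs.2.2 (Or.inr (Or.inl rfl))
  have hm : E.lastMove T x (i + 1) = E.restPos T x (i + 1) - E.restPos T x i := rfl
  have hN : 0 ≤ ‖E.lastMove T x (i + 1)‖ ^ 2 := by positivity
  have hR := E.reserve_le k x y (i + 1) j
  rw [hp, hm] at hin
  have hsq := dist_sq_le_of_inner_le hin
  rw [← hm] at hsq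
  rw [dist_comm] at h
  set N := ‖E.lastMove T x (i + 1)‖ ^ 2
  set a := E.restPos T x i
  set a' := E.restPos T x (i + 1)
  set b := E.restPos T y j
  set c := E.pos y (E.start x i)
  have hle : dist a' c ≤ dist a c := by
    refine abs_le_of_sq_le_sq' ?_ dist_nonneg |>.2
    nlinarith
  constructor
  · rintro v ⟨⟨-, hv⟩, ⟨hv', -⟩, hvT⟩
    have h₁ := E.dist_add_dist_restPos hs.2.1.1 hv' hv hvT
    change dist c (E.pos y v) + dist (E.pos y v) b = dist c b at h₁
    have h₂ := dist_triangle (E.pos y v) c a'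
    rw [dist_comm (E.pos y v) c, dist_comm c a'] at h₂
    linarith
  · have h₁ : dist b a' ^ 2 ≤ (dist a' c + dist c b) ^ 2 := by
      rw [dist_comm b]
      gcongr
      exact dist_triangle a' c b
    have h₂ : (dist a c + dist c b) ^ 2 ≤ V ^ 2 := by gcongr
    have h₃ := mul_le_mul_of_nonneg_right hle (dist_nonneg (x := c) (y := b))
    have h₄ := mul_le_mul_of_nonneg_right hR hN
    -- The gain `(4k - 1)N` covers the fresh reserve, at most `kN`.
    have h₅ : 0 ≤ (3 * k - 1) * N := mul_nonneg (by linarith) hN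
    nlinarith

/-- The reserve of the move that `x` has just completed is not needed on the right. The new move
funds its own, and the unfinished part of the move of `y` is paid from the reserve of `y`. -/
theorem energy_of_inner_le (hk : 1 ≤ k)
    (hs : E.AtStage T x y i j (E.start x i))
    (hin : inner ℝ (E.lastMove T x (i + 1)) (E.pos x (E.start x i) - E.pos y (E.start x i)) ≤
      -(2 * k) * ‖E.lastMove T x (i + 1)‖ ^ 2) :
    dist (E.restPos T x (i + 1)) (E.restPos T y j) ^ 2
        + E.reserve k x y (i + 1) j * ‖E.lastMove T x (i + 1)‖ ^ 2
        + E.reserve k y x j (i + 1) * ‖E.lastMove T y j‖ ^ 2 ≤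
      dist (E.restPos T x i) (E.restPos T y j) ^ 2
        + E.reserve k y x j i * ‖E.lastMove T y j‖ ^ 2 := by
  have hk' : (1 : ℝ) ≤ k := by exact_mod_cast hk
  have hp : E.pos x (E.start x i) = E.restPos T x i :=
    E.pos_eq_restPos hs.1.1 hs.1.2 hs.2.2 (Or.inr (Or.inl rfl))
  have hm : E.lastMove T x (i + 1) = E.restPos T x (i + 1) - E.restPos T x i := rfl
  have hN : 0 ≤ ‖E.lastMove T x (i + 1)‖ ^ 2 := by positivity
  rw [hp, hm] at hin
  have h₁ := dist_sq_le_of_inner_le_of_pending (b := E.restPos T y j) hin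
  rw [← hm] at h₁
  have h₂ := E.dist_sq_add_reserve_le k hs.2.1.1 hs.2.1.2 hs.2.2
  have h₃ := mul_le_mul_of_nonneg_right (E.reserve_le k x y (i + 1) j) hN
  have h₄ : 0 ≤ (3 * (k : ℝ) - 2) * ‖E.lastMove T x (i + 1)‖ ^ 2 :=
    mul_nonneg (by linarith) hN
  linarith

theorem Secure.succ_left (hE : E.IsKAsync k) (hxy : x ≠ y) (hk : 1 ≤ k)
    (h : E.Secure k V T x y i j) (hs : E.AtStage T x y i j (E.start x i))
    (hmx : ‖E.lastMove T x (i + 1)‖ ≤ V / 4) (hmy : ‖E.lastMove T y j‖ ≤ V / 4)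
    (hlook : E.StronglyVisible V x y (E.start x i) ∨
      inner ℝ (E.lastMove T x (i + 1)) (E.pos x (E.start x i) - E.pos y (E.start x i)) ≤
        -(2 * k) * ‖E.lastMove T x (i + 1)‖ ^ 2) :
    E.Secure k V T x y (i + 1) j := by
  rcases hlook with hlook | hin
  -- The witness is the instant of the look itself, now regarded as already counted.
  · exact AtStage.secure_of_stronglyVisible (u := E.start x i)
      ⟨⟨le_rfl, E.start_mono x i.le_succ⟩, hs.2.1, hs.2.2⟩ hmx hmy hlook
  rcases h with ⟨u, hu, h⟩ | h | h | h
  -- Robot `x` has reached its endpoint, and `y` has only consumed part of its remaining path since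
  -- `u`, so the sum bounded by `V` controls the path from `y` to both endpoints.
  · refine Or.inr (Or.inr (Or.inl (halfSecure_of_inner_le hk hs hin ?_)))
    have h₁ := E.dist_add_dist_restPos hu.2.1.1 hu.1.2 hs.2.1.2 hs.2.2
    have h₂ := dist_triangle4 (E.pos y (E.start x i)) (E.pos y u) (E.pos x u) (E.restPos T x i)
    rw [dist_comm (E.pos y (E.start x i)) (E.pos y u), dist_comm (E.pos y u) (E.pos x u)] at h₂
    linarith
  -- The unconfined move of `x` is over, so both last moves are now confined and the full energy
  -- bound takes over.
  · exact Or.inr (Or.inr (Or.inr ((energy_of_inner_le hk hs hin).trans h.2)))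
  · exact Or.inr (Or.inr (Or.inl (halfSecure_of_inner_le hk hs hin (h.1 _ hs.symm))))
  · refine Or.inr (Or.inr (Or.inr ((energy_of_inner_le hk hs hin).trans ?_)))
    have := mul_nonneg (hE.reserve_nonneg hxy i j) (sq_nonneg ‖E.lastMove T x i‖)
    linarith

end Invariant

-- Induction over the interleaved looks.

section Main

variable {E : Execution ι ξ} {k : ℕ} {V : ℝ} {x y : ι}

/-- The step of the invariant at a look of robot `x` before time `T`. -/
theorem Secure.look (hE : E.IsKAsync k) (hxy : x ≠ y) (hV : 0 ≤ V) (hk : 1 ≤ k)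
    (hx : E.ConfinesTo k V x y) (hy : E.ConfinesTo k V y x) {T : ℝ} {i j : ℕ}
    (h : E.Secure k V T x y i j) (hs : E.AtStage T x y i j (E.start x i))
    (hvis : E.Visible V x y (E.start x i)) : E.Secure k V T x y (i + 1) j := by
  exact h.succ_left hE hxy hk hs (hx.norm_lastMove_le hV hk hs.2.2)
    (hy.norm_lastMove_le hV hk (hs.2.1.1.trans hs.2.2))
    (hx.stronglyVisible_or_inner_le hV hk hxy hs.2.2 hvis)

theorem secure_of_secure (hE : E.IsKAsync k) (hxy : x ≠ y) (hV : 0 ≤ V) (hk : 1 ≤ k)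
    (hx : E.ConfinesTo k V x y) (hy : E.ConfinesTo k V y x) {t T : ℝ} {i₀ j₀ : ℕ}
    (ht : E.AtStage T x y i₀ j₀ t) (h₀ : E.Secure k V T x y i₀ j₀)
    (hvx : ∀ i, t ≤ E.start x i → E.start x i < T → E.Visible V x y (E.start x i))
    (hvy : ∀ j, t ≤ E.start y j → E.start y j < T → E.Visible V x y (E.start y j)) (n : ℕ) :
    ∀ i j, i + j = n → i₀ ≤ i → j₀ ≤ j → (i₀ < i → E.prevLook x i < T) →
      (j₀ < j → E.prevLook y j < T) → E.prevLook x i ≤ E.start y j →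
      E.prevLook y j ≤ E.start x i → E.Secure k V T x y i j := by
  induction n with
  | zero =>
    intro i j hn hi hj _ _ _ _
    obtain rfl : i = i₀ := by omega
    obtain rfl : j = j₀ := by omega
    exact h₀
  | succ n ih =>
    intro i j hn hi hj hiT hjT hij hji
    -- The later of the two last looks is undone; ties may be resolved either way, since `AtStage`
    -- accepts both counts at the time of a look.
    have key : (i = i₀ ∧ j = j₀) ∨ (i₀ < i ∧ E.prevLook y j ≤ E.prevLook x i) ∨
        (j₀ < j ∧ E.prevLook x i ≤ E.prevLook y j) := by
      rcases hi.eq_or_lt with rfl | hi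
      · rcases hj.eq_or_lt with rfl | hj
        · exact Or.inl ⟨rfl, rfl⟩
        · refine Or.inr (Or.inr ⟨hj, ht.1.1.trans (ht.2.1.2.trans ?_)⟩)
          obtain ⟨j, rfl⟩ := Nat.exists_eq_succ_of_ne_zero (Nat.ne_zero_of_lt hj)
          exact E.start_mono y (by omega)
      · rcases hj.eq_or_lt with rfl | hj
        · refine Or.inr (Or.inl ⟨hi, ht.2.1.1.trans (ht.1.2.trans ?_)⟩)
          obtain ⟨i, rfl⟩ := Nat.exists_eq_succ_of_ne_zero (Nat.ne_zero_of_lt hi)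
          exact E.start_mono x (by omega)
        · rcases le_total (E.prevLook y j) (E.prevLook x i) with h | h
          · exact Or.inr (Or.inl ⟨hi, h⟩)
          · exact Or.inr (Or.inr ⟨hj, h⟩)
    rcases key with ⟨rfl, rfl⟩ | ⟨hlt, hle⟩ | ⟨hlt, hle⟩
    · exact h₀
    · obtain ⟨i, rfl⟩ := Nat.exists_eq_succ_of_ne_zero (Nat.ne_zero_of_lt hlt)
      have hsT := hiT hlt
      refine (ih i j (by omega) (by omega) hj
        (fun _ => (E.prevLook_le_start x i).trans_lt hsT) hjT
        ((E.prevLook_le_start x i).trans hij) hle).look hE hxy hV hk hx hy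
        ⟨⟨E.prevLook_le_start x i, le_rfl⟩, ⟨hle, hij⟩, hsT.le⟩ (hvx i ?_ hsT)
      exact ht.1.2.trans (E.start_mono x (by omega))
    · obtain ⟨j, rfl⟩ := Nat.exists_eq_succ_of_ne_zero (Nat.ne_zero_of_lt hlt)
      have hsT := hjT hlt
      refine ((ih i j (by omega) hi (by omega) hiT
        (fun _ => (E.prevLook_le_start y j).trans_lt hsT) hle
        ((E.prevLook_le_start y j).trans hji)).symm.look hE hxy.symm hV hk hy hx
        ⟨⟨E.prevLook_le_start y j, le_rfl⟩, ⟨hle, hji⟩, hsT.le⟩ (hvy j ?_ hsT).symm).symm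
      exact ht.2.1.2.trans (E.start_mono y (by omega))

theorem atStage_lookCount (E : Execution ι ξ) (x y : ι) {t T : ℝ} (ht : 0 ≤ t) (htT : t ≤ T) :
    E.AtStage T x y (E.lookCount x t) (E.lookCount y t) t :=
  ⟨⟨E.prevLook_lookCount_le x ht, E.le_start_lookCount x t⟩,
    ⟨E.prevLook_lookCount_le y ht, E.le_start_lookCount y t⟩, htT⟩

/-- If the invariant holds at time `t`, whatever the later time at which motion is frozen, then
mutual visibility is preserved from then on. -/
theorem visible_of_secure (hE : E.IsKAsync k) (hxy : x ≠ y) (hV : 0 ≤ V) (hk : 1 ≤ k)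
    (hx : E.ConfinesTo k V x y) (hy : E.ConfinesTo k V y x) {t : ℝ} (ht : 0 ≤ t)
    (h₀ : ∀ T, t ≤ T → E.Secure k V T x y (E.lookCount x t) (E.lookCount y t)) (n : ℕ) :
    ∀ T, t ≤ T → E.lookCount x T + E.lookCount y T = n → E.Visible V x y T := by
  induction n using Nat.strong_induction_on with
  | _ n ih =>
    intro T htT hn
    have hT := ht.trans htT
    have hfin := E.atStage_lookCount x y hT le_rfl
    -- Visibility at each look before `T` is the present statement with that look as freezing time.
    have hsec := secure_of_secure hE hxy hV hk hx hy (E.atStage_lookCount x y ht htT) (h₀ T htT)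
      (fun i hti hiT => ih _ ?_ _ hti rfl) (fun j htj hjT => ih _ ?_ _ htj rfl) _
      _ _ rfl (E.lookCount_mono x htT) (E.lookCount_mono y htT)
      (fun h => E.prevLook_lookCount_lt x T (by omega))
      (fun h => E.prevLook_lookCount_lt y T (by omega))
      (hfin.1.1.trans hfin.2.1.2) (hfin.2.1.1.trans hfin.1.2)
    · have := hsec.dist_restPos_le hE hxy hV
      rwa [← E.pos_eq_restPos hfin.1.1 hfin.1.2 le_rfl (Or.inl rfl),
        ← E.pos_eq_restPos hfin.2.1.1 hfin.2.1.2 le_rfl (Or.inl rfl)] at this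
    -- A look is not counted at its own time but is counted at `T`, so the total strictly decreases.
    · have h₁ := E.lookCount_mono y hiT.le
      have h₂ := (E.lookCount_le_iff x (E.start x i) i).2 le_rfl
      have h₃ := mt (E.lookCount_le_iff x T i).1 hiT.not_ge
      omega
    · have h₁ := E.lookCount_mono x hjT.le
      have h₂ := (E.lookCount_le_iff y (E.start y j) j).2 le_rfl
      have h₃ := mt (E.lookCount_le_iff y T j).1 hjT.not_ge
      omega

end Main

end Execution

theorem mainTheorem2 {ι : Type*} [Finite ι] (V : ℝ) (hV : 0 < V) (k : ℕ) (hk : 1 ≤ k)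
    (ξ : ℝ) (hξ : 0 < ξ) (hξ1 : ξ ≤ 1) (E : Execution ι ξ) (hE : E.IsKAsync k)
    (x y : ι) (hxy : x ≠ y) (hx : E.ConfinesTo k V x y) (hy : E.ConfinesTo k V y x) :
    (E.Visible V x y 0 → ∀ t : ℝ, 0 ≤ t → E.Visible V x y t) ∧
    (∀ t : ℝ, 0 < t → E.StronglyVisible V x y t → ∀ t' : ℝ, t ≤ t' → E.Visible V x y t') := by
  constructor
  · intro h₀ t ht
    refine Execution.visible_of_secure hE hxy hV.le hk hx hy le_rfl (fun T hT => ?_) _ t ht rfl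
    have hz : ∀ z, E.lookCount z 0 = 0 := fun z =>
      Nat.le_zero.1 ((E.lookCount_le_iff z 0 0).2 (E.start_nonneg z))
    -- No look precedes time `0`, so both remaining paths vanish and the first alternative is the
    -- initial visibility.
    refine Or.inl ⟨0, E.atStage_lookCount x y le_rfl hT, ?_⟩
    simpa [hz, Execution.restPos, Execution.Visible] using h₀
  · intro t ht h t' ht'
    refine Execution.visible_of_secure hE hxy hV.le hk hx hy ht.le (fun T hT => ?_) _ t' ht' rfl
    have hst := E.atStage_lookCount x y ht.le hT
    exact hst.secure_of_stronglyVisible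
      (hx.norm_lastMove_le hV.le hk (hst.1.1.trans hT))
      (hy.norm_lastMove_le hV.le hk (hst.2.1.1.trans hT)) h
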